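/- A represented space is a set $X$ with a partial surjection $\delta_X:\subseteq\mathbb{N}^{\mathbb{N}}\to X$. A multi-valued function $f:\subseteq X\rightrightarrows Y$ between represented spaces assigns to each $x\in X$ a set $f(x)\subseteq Y$, with $\operatorname{dom}(f)=\{x: f(x)\neq\emptyset\}$; it is continuous if it has a realizer $F:\subseteq\mathbb{N}^{\mathbb{N}}\to\mathbb{N}^{\mathbb{N}}$ (that is, $\delta_Y(F(p))\in f(\delta_X(p))$ for all $p$ with $\delta_X(p)\in\operatorname{dom}(f)$) that is continuous on its domain. We write $f\le_W g$ if there are computable $K,H:\subseteq\mathbb{N}^{\mathbb{N}}\to\mathbb{N}^{\mathbb{N}}$ such that $K\langle\mathrm{id},GH\rangle$ realizes $f$ whenever $G$ realizes $g$, and we add a top element $\infty$. Let $0$ be the nowhere defined multi-valued function and $1$ the identity of the one-point space with total representation. Let $\mathcal{M}(Y,V)$ be the represented space of strongly continuous multi-valued functions $:\subseteq Y\rightrightarrows V$, that is, those of the form $\delta_V\circ\Phi_p\circ(\delta_Y^{\mathrm{cyl}})^{-1}$ with $p\in\mathbb{N}^{\mathbb{N}}$, where $\Phi_p$ is the partial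 function computed by a universal machine with parameter $p$ and $\delta_Y^{\mathrm{cyl}}\langle q,r\rangle=\delta_Y(q)$; such a $p$ is a name of the function. The composition $h\circ g$ of multi-valued functions is defined at $x$ iff $x\in\operatorname{dom}(g)$ and $g(x)\subseteq\operatorname{dom}(h)$, and then $(h\circ g)(x)=\bigcup_{y\in g(x)}h(y)$. For $g:\subseteq X\rightrightarrows Y$ and $f:\subseteq U\rightrightarrows V$ with $\operatorname{dom}(g)\neq\emptyset$ or $\operatorname{dom}(f)=\emptyset$, let $(g\to f):\subseteq U\rightrightarrows\mathcal{M}(Y,V)\times X$ be given by $(h,x)\in(g\to f)(u)$ iff $x\in\operatorname{dom}(h\circ g)$ and $(h\circ g)(x)\subseteq f(u)$; if $\operatorname{dom}(g)=\emptyset$ and $\operatorname{dom}(f)\neq\emptyset$, let $(g\to f)=\infty$. Moreover $(\infty\to f)=0$ for every $f$, including $f=\infty$, and $(g\to\infty)=\infty$ for $g\neq\infty$. (1) A multi-valued function $f$ between represented spaces is continuous if and only if there is some $g>_W 0$ (a multi-valued function or $\infty$) with $f\le_W(g\to 1)$. (2) Hence continuity is definable in the Weihrauch degrees: in the first-order structure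 whose universe is the set of Weihrauch degrees (including $\infty$), with the order $\le_W$ and the (graph of the) operation $\to$ as its only relations, the set of the degrees of continuous multi-valued functions is definable by a first-order formula without parameters. -/

import Mathlib

universe u v w z u₁ v₁ u₂ v₂ u₃ v₃

namespace Weihrauch

/-! ### Oracle machines and partial functions on Baire space -/

/-- Baire space, with its product topology. -/
abbrev Baire : Type := ℕ → ℕ

/-- The standard pairing `⟨p, q⟩` on Baire space (a computable homeomorphism). -/
def pair (p q : Baire) : Baire := fun n => Nat.pair (p n) (q n)

/-- First component of a pair. -/
def fst (r : Baire) : Baire := fun n => (r n).unpair.1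

/-- Second component of a pair. -/
def snd (r : Baire) : Baire := fun n => (r n).unpair.2

@[simp] theorem fst_pair (p q : Baire) : fst (pair p q) = p := by
  funext n; simp [fst, pair]

@[simp] theorem snd_pair (p q : Baire) : snd (pair p q) = q := by
  funext n; simp [snd, pair]

/-- Programs of oracle machines: the codes for partial recursive functions, with one further basic
instruction that queries the oracle. -/
inductive Code : Type
  | zero : Code
  | succ : Code
  | left : Code
  | right : Code
  | oracle : Code
  | pair : Code → Code → Code
  | comp : Code → Code → Code
  | prec : Code → Code → Code
  | rfind' : Code → Code

namespace Code

/-- The partial function on `ℕ` computed by a program with oracle `o`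
(as `Nat.Partrec.Code.eval`, relativized). -/
def eval (o : Baire) : Code → ℕ →. ℕ
  | zero => pure 0
  | succ => Nat.succ
  | left => ↑fun n : ℕ => n.unpair.1
  | right => ↑fun n : ℕ => n.unpair.2
  | oracle => ↑fun n : ℕ => o n
  | pair cf cg => fun n => Nat.pair <$> eval o cf n <*> eval o cg n
  | comp cf cg => fun n => eval o cg n >>= eval o cf
  | prec cf cg =>
    Nat.unpaired fun a n =>
      n.rec (eval o cf a) fun y IH => do
        let i ← IH
        eval o cg (Nat.pair a (Nat.pair y i))
  | rfind' cf =>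
    Nat.unpaired fun a m =>
      (Nat.rfind fun n => (fun m => m = 0) <$> eval o cf (Nat.pair a (n + m))).map (· + m)

/-- The (effective, surjective) standard numbering of the programs. -/
def ofNat : ℕ → Code
  | 0 => zero
  | 1 => succ
  | 2 => left
  | 3 => right
  | 4 => oracle
  | n + 5 =>
    let m := n.div2.div2
    have hm : m < n + 5 := by
      simp only [m, Nat.div2_val]
      exact lt_of_le_of_lt (le_trans (Nat.div_le_self _ _) (Nat.div_le_self _ _)) (by omega)
    have _m1 : m.unpair.1 < n + 5 := lt_of_le_of_lt m.unpair_left_le hm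
    have _m2 : m.unpair.2 < n + 5 := lt_of_le_of_lt m.unpair_right_le hm
    match n.bodd, n.div2.bodd with
    | false, false => pair (ofNat m.unpair.1) (ofNat m.unpair.2)
    | false, true => comp (ofNat m.unpair.1) (ofNat m.unpair.2)
    | true, false => prec (ofNat m.unpair.1) (ofNat m.unpair.2)
    | true, true => rfind' (ofNat m)
decreasing_by all_goals first | exact _m1 | exact _m2 | exact hm

/-- The type-2 function computed by a machine: on input `q` (given as the oracle) it outputs `r`
iff for every `n` the computation of the `n`-th output symbol halts with result `r n`. The domain
consists of all inputs on which infinitely many output symbols are produced. -/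
def functional (c : Code) : Baire →. Baire := fun q =>
  ⟨∀ n, (c.eval q n).Dom, fun h n => (c.eval q n).get (h n)⟩

theorem mem_functional {c : Code} {q r : Baire} :
    r ∈ c.functional q ↔ ∀ n, r n ∈ c.eval q n := by
  constructor
  · rintro ⟨h, rfl⟩ n
    exact ⟨h n, rfl⟩
  · intro h
    exact ⟨fun n => (h n).1, funext fun n => (h n).2⟩

/-- Replace the oracle by the output of a program. -/
def subst (d : Code) : Code → Code
  | zero => zero
  | succ => succ
  | left => left
  | right => right
  | oracle => d
  | pair cf cg => pair (subst d cf) (subst d cg)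
  | comp cf cg => comp (subst d cf) (subst d cg)
  | prec cf cg => prec (subst d cf) (subst d cg)
  | rfind' cf => rfind' (subst d cf)

theorem eval_subst {d : Code} {o o' : Baire} (h : o' ∈ d.functional o) (c : Code) :
    eval o (subst d c) = eval o' c := by
  induction c with
  | oracle =>
    funext n
    exact Part.eq_some_iff.2 (mem_functional.1 h n)
  | pair cf cg hf hg => simp only [subst, eval, hf, hg]; rfl
  | comp cf cg hf hg => simp only [subst, eval, hf, hg]; rfl
  | prec cf cg hf hg => simp only [subst, eval, hf, hg]; rfl
  | rfind' cf hf => simp only [subst, eval, hf]; rfl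
  | _ => rfl

theorem mem_functional_subst {c d : Code} {o o' r : Baire} (h : o' ∈ d.functional o)
    (hr : r ∈ c.functional o') : r ∈ (subst d c).functional o := by
  rw [mem_functional] at hr ⊢
  rwa [eval_subst h]

theorem mem_functional_pair {c d : Code} {o p q : Baire} (hp : p ∈ c.functional o)
    (hq : q ∈ d.functional o) : Weihrauch.pair p q ∈ (pair c d).functional o := by
  rw [mem_functional] at hp hq ⊢
  intro n
  simp [eval, Part.eq_some_iff.2 (hp n), Part.eq_some_iff.2 (hq n), Weihrauch.pair, Seq.seq]

theorem fst_mem_functional (o : Baire) : fst o ∈ (comp left oracle).functional o := by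
  rw [mem_functional]
  intro n
  exact Part.mem_bind (Part.mem_some _) (Part.mem_some _)

theorem snd_mem_functional (o : Baire) : snd o ∈ (comp right oracle).functional o := by
  rw [mem_functional]
  intro n
  exact Part.mem_bind (Part.mem_some _) (Part.mem_some _)

theorem self_mem_functional (o : Baire) : o ∈ oracle.functional o := by
  rw [mem_functional]
  intro n
  simp [eval]

end Code

/-- A partial function on Baire space is computable if some machine computes it on its domain. -/
def IsComputable (F : Baire →. Baire) : Prop :=
  ∃ c : Code, ∀ p, ∀ r ∈ F p, r ∈ c.functional p

/-- A partial function on Baire space is continuous if it is continuous on its domain. -/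
def IsContinuous (F : Baire →. Baire) : Prop :=
  Continuous F.asSubtype

/-- The universal machine `Φ`: the first symbol of `p` selects a program, which is run on the input
`q` with the remaining symbols of `p` as a parameter. -/
def Phi (p : Baire) : Baire →. Baire := fun q =>
  (Code.ofNat (p 0)).functional (pair (fun n => p (n + 1)) q)

/-! ### Represented spaces -/

/-- A represented space: a set with a partial surjection from Baire space onto it. -/
structure RepSpace where
  carrier : Type u
  δ : Baire →. carrier
  surj : ∀ x, ∃ p, x ∈ δ p

namespace RepSpace

/-- The one-point space with total representation. -/
def one : RepSpace.{u} where
  carrier := PUnit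
  δ := fun _ => Part.some PUnit.unit
  surj := fun _ => ⟨fun _ => 0, by simp⟩

/-- The product of represented spaces: `⟨p, q⟩` is a name of `(x, y)` iff `p` is a name of `x` and
`q` is a name of `y`. -/
def prod (X : RepSpace.{u}) (Y : RepSpace.{v}) : RepSpace.{max u v} where
  carrier := X.carrier × Y.carrier
  δ := fun r => (X.δ (fst r)).bind fun x => (Y.δ (snd r)).map fun y => (x, y)
  surj := by
    rintro ⟨x, y⟩
    obtain ⟨p, hp⟩ := X.surj x
    obtain ⟨q, hq⟩ := Y.surj y
    refine ⟨pair p q, ?_⟩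
    simp [hp, hq]

/-- The multi-valued function `Φ_p^{X,Y} = δ_Y ∘ Φ_p ∘ (δ_X^cyl)⁻¹`, where
`δ_X^cyl ⟨p, q⟩ = δ_X p`. -/
def phiMulti (X : RepSpace.{u}) (Y : RepSpace.{v}) (p : Baire) (x : X.carrier) :
    Set Y.carrier :=
  {y | (∀ q, x ∈ X.δ (fst q) → ∃ r ∈ Phi p q, (Y.δ r).Dom) ∧
    ∃ q, x ∈ X.δ (fst q) ∧ ∃ r ∈ Phi p q, y ∈ Y.δ r}

/-- The represented space `M(X, Y)` of strongly continuous multi-valued functions. -/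
def strongCont (X : RepSpace.{u}) (Y : RepSpace.{v}) : RepSpace.{max u v} where
  carrier := {h : X.carrier → Set Y.carrier // ∃ p, h = phiMulti X Y p}
  δ := fun p => Part.some ⟨phiMulti X Y p, p, rfl⟩
  surj := by
    rintro ⟨_, p, rfl⟩
    exact ⟨p, by simp⟩

end RepSpace

/-! ### Multi-valued functions and Weihrauch reducibility -/

/-- A multi-valued function `f :⊆ X ⇉ Y` between represented spaces; its domain is the set of points
at which it has at least one value. -/
structure Problem where
  X : RepSpace.{u}
  Y : RepSpace.{v}
  f : X.carrier → Set Y.carrier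

/-- Composition of multi-valued functions: `x` is in the domain of `h ∘ g` iff `x ∈ dom g` and
`g x ⊆ dom h`. -/
def multiComp {A : Type u} {B : Type v} {C : Type w} (h : B → Set C) (g : A → Set B) (x : A) :
    Set C :=
  {c | (∀ b ∈ g x, (h b).Nonempty) ∧ ∃ b ∈ g x, c ∈ h b}

namespace Problem

/-- The domain of a multi-valued function. -/
def dom (f : Problem.{u, v}) : Set f.X.carrier := {x | (f.f x).Nonempty}

/-- `F ⊢ f`: the partial function `F` is a realizer of `f`. -/
def Realizes (F : Baire →. Baire) (f : Problem.{u, v}) : Prop :=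
  ∀ p, ∀ x ∈ f.X.δ p, x ∈ f.dom → ∃ r ∈ F p, ∃ y ∈ f.Y.δ r, y ∈ f.f x

/-- A multi-valued function is continuous if it has a continuous realizer. -/
def IsContinuous (f : Problem.{u, v}) : Prop :=
  ∃ F, Realizes F f ∧ Weihrauch.IsContinuous F

/-- The partial function `K⟨id, G H⟩`. -/
def sandwich (K H G : Baire →. Baire) : Baire →. Baire := fun p =>
  (H p).bind fun h => (G h).bind fun y => K (pair p y)

/-- Weihrauch reducibility `f ≤_W g`. -/
def Reducible (f : Problem.{u, v}) (g : Problem.{w, z}) : Prop :=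
  ∃ K H : Baire →. Baire, IsComputable K ∧ IsComputable H ∧
    ∀ G, Realizes G g → Realizes (sandwich K H G) f

theorem Reducible.refl (f : Problem.{u, v}) : Reducible f f := by
  refine ⟨fun r => Part.some (snd r), fun p => Part.some p,
    ⟨.comp .right .oracle, fun p r hr => ?_⟩, ⟨.oracle, fun p r hr => ?_⟩, fun G hG p x hx hd => ?_⟩
  · obtain rfl := Part.mem_some_iff.1 hr
    exact Code.snd_mem_functional p
  · obtain rfl := Part.mem_some_iff.1 hr
    exact Code.self_mem_functional _
  · obtain ⟨r, hr, y, hy, hyx⟩ := hG p x hx hd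
    exact ⟨r, by simpa [sandwich] using hr, y, hy, hyx⟩

theorem Reducible.trans {f : Problem.{u₁, v₁}} {g : Problem.{u₂, v₂}}
    {h : Problem.{u₃, v₃}} (hfg : Reducible f g) (hgh : Reducible g h) : Reducible f h := by
  obtain ⟨K₁, H₁, ⟨k₁, hk₁⟩, ⟨h₁, hh₁⟩, h1⟩ := hfg
  obtain ⟨K₂, H₂, ⟨k₂, hk₂⟩, ⟨h₂, hh₂⟩, h2⟩ := hgh
  refine ⟨fun r => (H₁ (fst r)).bind fun a => (K₂ (pair a (snd r))).bind fun b =>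
      K₁ (pair (fst r) b), fun p => (H₁ p).bind H₂,
    ⟨Code.subst (.pair (.comp .left .oracle) (Code.subst (.pair
      (Code.subst (.comp .left .oracle) h₁) (.comp .right .oracle)) k₂)) k₁, fun p r hr => ?_⟩,
    ⟨Code.subst h₁ h₂, fun p r hr => ?_⟩, fun G hG => ?_⟩
  · obtain ⟨a, ha, hr⟩ := Part.mem_bind_iff.1 hr
    obtain ⟨b, hb, hr⟩ := Part.mem_bind_iff.1 hr
    exact Code.mem_functional_subst (Code.mem_functional_pair (Code.fst_mem_functional p)
      (Code.mem_functional_subst (Code.mem_functional_pair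
        (Code.mem_functional_subst (Code.fst_mem_functional p) (hh₁ _ _ ha))
        (Code.snd_mem_functional p)) (hk₂ _ _ hb))) (hk₁ _ _ hr)
  · obtain ⟨a, ha, hr⟩ := Part.mem_bind_iff.1 hr
    exact Code.mem_functional_subst (hh₁ _ _ ha) (hh₂ _ _ hr)
  · intro p x hx hd
    obtain ⟨r, hr, hy⟩ := h1 _ (h2 G hG) p x hx hd
    refine ⟨r, ?_, hy⟩
    obtain ⟨a, ha, hr⟩ := Part.mem_bind_iff.1 hr
    obtain ⟨b, hb, hr⟩ := Part.mem_bind_iff.1 hr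
    obtain ⟨c, hc, hb⟩ := Part.mem_bind_iff.1 hb
    obtain ⟨d, hd, hb⟩ := Part.mem_bind_iff.1 hb
    refine Part.mem_bind (Part.mem_bind ha hc) (Part.mem_bind hd ?_)
    change r ∈ (H₁ (fst (pair p d))).bind fun a => (K₂ (pair a (snd (pair p d)))).bind fun b =>
      K₁ (pair (fst (pair p d)) b)
    rw [fst_pair, snd_pair]
    exact Part.mem_bind ha (Part.mem_bind hb hr)

/-- The nowhere defined multi-valued function, a representative of the degree `0`. -/
def zero : Problem.{u, v} where
  X := RepSpace.one
  Y := RepSpace.one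
  f := fun _ => ∅

/-- The identity of the one-point space, a representative of the degree `1`. -/
def one : Problem.{u, u} where
  X := RepSpace.one
  Y := RepSpace.one
  f := fun x => {x}

/-- The multi-valued function `(g → f) :⊆ U ⇉ M(Y, V) × X` for `g :⊆ X ⇉ Y` and `f :⊆ U ⇉ V`: the
values at `u` are the pairs `(h, x)` with `x ∈ dom (h ∘ g)` and `(h ∘ g) x ⊆ f u`. -/
def arrow (g : Problem.{w, z}) (f : Problem.{u, v}) : Problem.{u, max w z v} where
  X := f.X
  Y := (RepSpace.strongCont g.Y f.Y).prod g.X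
  f := fun u => {hx | (multiComp hx.1.1 g.f hx.2).Nonempty ∧ multiComp hx.1.1 g.f hx.2 ⊆ f.f u}

end Problem

/-- Multi-valued functions together with an additional top element `∞`. -/
inductive ExtProblem
  | of (f : Problem.{u, v}) : ExtProblem
  | infty : ExtProblem

namespace ExtProblem

/-- Weihrauch reducibility, extended so that `∞` is the top element. -/
def Reducible : ExtProblem.{u, v} → ExtProblem.{w, z} → Prop
  | _, infty => True
  | infty, of _ => False
  | of f, of g => f.Reducible g

/-- Strict Weihrauch reducibility `a <_W b`. -/
def StrictReducible (a : ExtProblem.{u, v}) (b : ExtProblem.{w, z}) : Prop :=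
  Reducible a b ∧ ¬ Reducible b a

open Classical in
/-- The implication `(a → b)`, with the conventions `(∞ → b) = 0` for all `b`, `(g → ∞) = ∞` for
`g ≠ ∞`, and `(g → f) = ∞` if `g` is nowhere defined but `f` is not. -/
noncomputable def arrow : ExtProblem.{w, z} → ExtProblem.{u, v} → ExtProblem.{u, max w z v}
  | infty, _ => of Problem.zero
  | of _, infty => infty
  | of g, of f => if g.dom.Nonempty ∨ f.dom = ∅ then of (g.arrow f) else infty

instance : IsPreorder ExtProblem.{u, v} Reducible where
  refl
    | infty => trivial
    | of f => Problem.Reducible.refl f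
  trans
    | _, _, infty, _, _ => trivial
    | infty, of _, of _, h, _ => h.elim
    | _, infty, of _, _, h => h.elim
    | of _, of _, of _, h, h' => Problem.Reducible.trans h h'

end ExtProblem

/-! ### The structure of the Weihrauch degrees -/

/-- The Weihrauch degrees (including the top degree `∞`): equivalence classes with respect to
reducibility in both directions. -/
def Degree : Type 1 :=
  Antisymmetrization ExtProblem.{0, 0} ExtProblem.Reducible

/-- The Weihrauch degree of a multi-valued function (or of `∞`). -/
def deg (a : ExtProblem.{0, 0}) : Degree := toAntisymmetrization ExtProblem.Reducible a

/-- The order of the Weihrauch degrees. -/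
def Degree.le (a b : Degree) : Prop :=
  ∃ f g, deg f = a ∧ deg g = b ∧ ExtProblem.Reducible f g

/-- The graph of the implication on Weihrauch degrees: `(a → b) = c`. -/
def Degree.IsArrow (a b c : Degree) : Prop :=
  ∃ g f, deg g = a ∧ deg f = b ∧ deg (ExtProblem.arrow g f) = c

/-- The relation symbols: `≤` (binary) and the graph of `→` (ternary). -/
inductive DegreeRel : ℕ → Type
  | le : DegreeRel 2
  | arrow : DegreeRel 3

/-- The first-order language whose only symbols are `≤` and (the graph of) `→`. -/
def degreeLanguage : FirstOrder.Language where
  Functions := fun _ => Empty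
  Relations := DegreeRel

/-- The Weihrauch degrees as a first-order structure. -/
instance : degreeLanguage.Structure Degree where
  funMap := fun f => nomatch f
  RelMap := fun {_} r => match r with
    | .le => fun x => Degree.le (x 0) (x 1)
    | .arrow => fun x => Degree.IsArrow (x 0) (x 1) (x 2)

/-- A Weihrauch degree is continuous if it is the degree of a continuous multi-valued function. -/
def Degree.IsContinuous (a : Degree) : Prop :=
  ∃ f : Problem.{0, 0}, f.IsContinuous ∧ deg (.of f) = a

end Weihrauch

/-! A continuous partial function on Baire space is computable relative to some oracle: finitely
many input symbols decide each output symbol, so it suffices to tabulate which prefixes decide which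
symbols, and how (`IsContinuous.exists_table`, `Code.mem_applyTable`). To supply this oracle `q`,
take for `g` the problem whose only instance is `q`: every solution of `(g → 1)` carries a name of
an instance of `g`, hence `q` itself, and a solution of `f` is computed from it.

Conversely, if `g` has an instance, then one fixed instance, paired with a machine that ignores the
answer and prints a solution of `f`, solves `(g → f)`; so `(g → f)` is continuous whenever `f` is
(`Problem.IsContinuous.arrow`). Continuity passes down along reductions, because machines are
continuous by the use principle. For `g = ∞` the implication is `0`.

For definability, `0` is the least degree and `1` the greatest one of the form `(a → a)`: a
reduction of `f` to `g` is itself a computable solution of `(g → f)`, whence `(g → f) ≤ 1`, and `1 ≤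
(1 → 1)`. The first claim then becomes a formula. -/

open Topology Filter

namespace Weihrauch

/-! ### Continuity of partial functions -/

/-- Pointwise formulation of continuity of a partial function on its domain. -/
theorem isContinuous_iff {F : Baire →. Baire} :
    IsContinuous F ↔ ∀ p, ∀ r ∈ F p, ∀ U ∈ 𝓝 r, ∀ᶠ p' in 𝓝 p, ∀ r' ∈ F p', r' ∈ U := by
  constructor
  · rintro hF p r ⟨hd : p ∈ F.Dom, rfl⟩ U hU
    have h : ∀ᶠ x in 𝓝 (⟨p, hd⟩ : F.Dom), F.asSubtype x ∈ U := hF.continuousAt hU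
    rw [nhds_subtype_eq_comap, eventually_comap] at h
    filter_upwards [h] with p' h' r' hr'
    obtain ⟨hd', rfl⟩ := hr'
    exact h' ⟨p', hd'⟩ rfl
  · intro h
    refine continuous_iff_continuousAt.2 fun ⟨p, (hd : p ∈ F.Dom)⟩ U hU => ?_
    have := h p _ (Part.get_mem hd) U hU
    rw [mem_map, nhds_subtype_eq_comap, mem_comap]
    exact ⟨_, this, fun ⟨p', hd'⟩ hp' => hp' _ (Part.get_mem hd')⟩

theorem IsContinuous.mono {F G : Baire →. Baire} (hG : IsContinuous G)
    (h : ∀ p, ∀ r ∈ F p, r ∈ G p) : IsContinuous F := by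
  rw [isContinuous_iff] at hG ⊢
  intro p r hr U hU
  filter_upwards [hG p r (h p r hr) U hU] with p' hp' r' hr'
  exact hp' r' (h p' r' hr')

theorem IsContinuous.map {F : Baire →. Baire} (hF : IsContinuous F) {g : Baire → Baire}
    (hg : Continuous g) : IsContinuous (F.map g) := by
  rw [isContinuous_iff] at hF ⊢
  intro p r hr U hU
  obtain ⟨s, hs, rfl⟩ := (Part.mem_map_iff _).1 hr
  filter_upwards [hF p s hs _ (hg.continuousAt hU)] with p' hp' r' hr'
  obtain ⟨s', hs', rfl⟩ := (Part.mem_map_iff _).1 hr'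
  exact hp' s' hs'

theorem continuous_pair : Continuous fun x : Baire × Baire => pair x.1 x.2 := by
  refine continuous_pi fun n => ?_
  have h : Continuous fun x : Baire × Baire => (x.1 n, x.2 n) := by fun_prop
  exact (continuous_of_discreteTopology (f := fun y : ℕ × ℕ => Nat.pair y.1 y.2)).comp h

theorem IsContinuous.sandwich {K H G : Baire →. Baire} (hK : IsContinuous K)
    (hH : IsContinuous H) (hG : IsContinuous G) : IsContinuous (Problem.sandwich K H G) := by
  rw [isContinuous_iff] at hK hH hG ⊢
  intro p r hr U hU
  obtain ⟨a, ha, hr⟩ := Part.mem_bind_iff.1 hr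
  obtain ⟨b, hb, hr⟩ := Part.mem_bind_iff.1 hr
  -- The input reaches `K` both directly and through `G` and `H`, so the neighbourhood of `pair p b`
  -- is split into one of `p` and one of `b`.
  have hc : ∀ᶠ x in 𝓝 p ×ˢ 𝓝 b, ∀ r' ∈ K (pair x.1 x.2), r' ∈ U := by
    rw [← nhds_prod_eq]
    exact (continuous_pair.tendsto (p, b)).eventually (hK _ _ hr U hU)
  obtain ⟨P, hP, Q, hQ, hPQ⟩ := eventually_prod_iff.1 hc
  filter_upwards [hP, hH p a ha _ (hG a b hb _ hQ)] with p' hp' hp'' r' hr'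
  obtain ⟨a', ha', hr'⟩ := Part.mem_bind_iff.1 hr'
  obtain ⟨b', hb', hr'⟩ := Part.mem_bind_iff.1 hr'
  exact hPQ hp' (hp'' a' ha' b' hb') r' hr'

/-! ### Machines compute continuous functions -/

namespace Code

variable {o : Baire} {cf cg : Code} {n v a m : ℕ}

theorem mem_eval_pair :
    v ∈ (pair cf cg).eval o n ↔
      ∃ a b, a ∈ cf.eval o n ∧ b ∈ cg.eval o n ∧ Nat.pair a b = v := by
  simp [eval, Seq.seq]

theorem mem_eval_comp :
    v ∈ (comp cf cg).eval o n ↔ ∃ a, a ∈ cg.eval o n ∧ v ∈ cf.eval o a :=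
  Part.mem_bind_iff

theorem eval_prec_zero : (prec cf cg).eval o (Nat.pair a 0) = cf.eval o a := by
  simp [eval, Nat.unpaired]

theorem mem_eval_prec_succ :
    v ∈ (prec cf cg).eval o (Nat.pair a (m + 1)) ↔
      ∃ i, i ∈ (prec cf cg).eval o (Nat.pair a m) ∧
        v ∈ cg.eval o (Nat.pair a (Nat.pair m i)) := by
  simp [eval, Nat.unpaired]

/-- Nonzero values are written as `w + 1`, so that halting is expressed only through memberships in
`eval`, as the use principle needs. -/
theorem mem_eval_rfind' :
    v ∈ (rfind' cf).eval o (Nat.pair a m) ↔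
      ∃ k, k + m = v ∧ 0 ∈ cf.eval o (Nat.pair a (k + m)) ∧
        ∀ i ∈ Set.Iio k, ∃ w, w + 1 ∈ cf.eval o (Nat.pair a (i + m)) := by
  simp only [eval, Nat.unpaired, Nat.unpair_pair, Part.mem_map_iff]
  refine exists_congr fun k => (and_comm.trans (and_congr_right fun _ => ?_))
  refine Nat.mem_rfind.trans ?_
  simp only [Part.map_eq_map, Part.mem_map_iff, decide_eq_true_eq, exists_eq_right,
    decide_eq_false_iff_not, Set.mem_Iio]
  refine and_congr_right fun _ => ⟨fun h i hi => ?_, fun h i hi => ?_⟩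
  · obtain ⟨w, hw, h0⟩ := h hi
    exact ⟨w - 1, by rwa [Nat.sub_add_cancel (Nat.pos_of_ne_zero h0)]⟩
  · obtain ⟨w, hw⟩ := h i hi
    exact ⟨w + 1, hw, w.succ_ne_zero⟩

/-- The use principle: a halting computation queries only finitely many oracle symbols. -/
theorem isOpen_setOf_mem_eval (c : Code) (n v : ℕ) : IsOpen {o : Baire | v ∈ c.eval o n} := by
  induction c generalizing n v with
  | zero => exact isOpen_const (p := v ∈ zero.eval 0 n)
  | succ => exact isOpen_const (p := v ∈ succ.eval 0 n)
  | left => exact isOpen_const (p := v ∈ left.eval 0 n)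
  | right => exact isOpen_const (p := v ∈ right.eval 0 n)
  | oracle =>
    have : {o : Baire | v ∈ oracle.eval o n} = (fun o : Baire => o n) ⁻¹' {v} := by
      ext o
      simp [eval, eq_comm]
    rw [this]
    exact (isOpen_discrete _).preimage (continuous_apply n)
  | pair cf cg hf hg =>
    simp only [mem_eval_pair, Set.ofPred_exists, Set.ofPred_and]
    exact isOpen_iUnion fun a => isOpen_iUnion fun b =>
      (hf n a).inter ((hg n b).inter isOpen_const)
  | comp cf cg hf hg =>
    simp only [mem_eval_comp, Set.ofPred_exists, Set.ofPred_and]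
    exact isOpen_iUnion fun a => (hg n a).inter (hf a v)
  | prec cf cg hf hg =>
    obtain ⟨⟨a, m⟩, rfl⟩ := Nat.pairEquiv.surjective n
    rw [Nat.pairEquiv_apply, Function.uncurry_apply_pair]
    induction m generalizing v with
    | zero => simpa only [eval_prec_zero] using hf a v
    | succ m ih =>
      simp only [mem_eval_prec_succ, Set.ofPred_exists, Set.ofPred_and]
      exact isOpen_iUnion fun i => (ih i).inter (hg _ v)
  | rfind' cf hf =>
    obtain ⟨⟨a, m⟩, rfl⟩ := Nat.pairEquiv.surjective n
    rw [Nat.pairEquiv_apply, Function.uncurry_apply_pair]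
    simp only [mem_eval_rfind', Set.ofPred_exists, Set.ofPred_and, Set.ofPred_forall]
    -- A successful search has tested only finitely many candidates, so the intersection over `i <
    -- k` stays open.
    exact isOpen_iUnion fun k => isOpen_const.inter ((hf _ _).inter
      ((Set.finite_Iio k).isOpen_biInter fun i _ => isOpen_iUnion fun w => hf _ _))

theorem isContinuous_functional (c : Code) : IsContinuous c.functional := by
  refine continuous_pi fun n => continuous_discrete_rng.2 fun v => ?_
  have : (fun x : c.functional.Dom => c.functional.asSubtype x n) ⁻¹' {v} =
      Subtype.val ⁻¹' {o | v ∈ c.eval o n} := by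
    ext ⟨p, hp⟩
    have h := mem_functional.1 (Part.get_mem hp) n
    constructor
    · rintro rfl
      exact h
    · intro h'
      exact Part.mem_unique h h'
  exact this ▸ (isOpen_setOf_mem_eval c n v).preimage continuous_subtype_val

end Code

theorem IsComputable.isContinuous {F : Baire →. Baire} (hF : IsComputable F) :
    IsContinuous F := by
  obtain ⟨c, hc⟩ := hF
  exact c.isContinuous_functional.mono hc

/-! ### Continuity and nowhere defined problems under reducibility -/

namespace Problem

theorem IsContinuous.of_reducible {f : Problem.{u₁, v₁}} {g : Problem.{u₂, v₂}}
    (hg : g.IsContinuous) (h : f.Reducible g) : f.IsContinuous := by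
  obtain ⟨K, H, hK, hH, hKH⟩ := h
  obtain ⟨G, hG, hGc⟩ := hg
  exact ⟨_, hKH G hG, hK.isContinuous.sandwich hH.isContinuous hGc⟩

theorem isContinuous_of_dom_eq_empty {f : Problem.{u, v}} (h : f.dom = ∅) : f.IsContinuous :=
  ⟨fun _ => Part.none, fun _ x _ hx => absurd hx (h ▸ Set.notMem_empty x),
    isContinuous_iff.2 fun _ r hr => absurd hr (Part.notMem_none r)⟩

theorem dom_zero : zero.{u, v}.dom = ∅ := by
  exact Set.eq_empty_iff_forall_notMem.2 fun x hx => Set.not_nonempty_empty hx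

theorem Reducible.of_dom_eq_empty {f : Problem.{u₁, v₁}} (h : f.dom = ∅)
    (g : Problem.{u₂, v₂}) : f.Reducible g :=
  ⟨fun _ => Part.none, fun _ => Part.none, ⟨.zero, fun _ r hr => absurd hr (Part.notMem_none r)⟩,
    ⟨.zero, fun _ r hr => absurd hr (Part.notMem_none r)⟩,
    fun _ _ _ x _ hx => absurd hx (h ▸ Set.notMem_empty x)⟩

theorem Reducible.dom_eq_empty {f : Problem.{u₁, v₁}} {g : Problem.{u₂, v₂}}
    (h : f.Reducible g) (hg : g.dom = ∅) : f.dom = ∅ := by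
  obtain ⟨K, H, -, -, hKH⟩ := h
  refine Set.eq_empty_iff_forall_notMem.2 fun x hx => ?_
  obtain ⟨p, hp⟩ := f.X.surj x
  -- The nowhere defined function realizes `g`, and its sandwich has no outputs at all.
  obtain ⟨r, hr, -⟩ := hKH (fun _ => Part.none)
    (fun _ x _ hx => absurd hx (hg ▸ Set.notMem_empty x)) p x hp hx
  simp [sandwich] at hr

theorem isContinuous_one : one.{u}.IsContinuous :=
  ⟨fun p => Part.some p, fun p x _ _ => ⟨p, Part.mem_some p, x, Part.mem_some _, rfl⟩,
    isContinuous_iff.2 fun p r hr U hU => by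
      obtain rfl := Part.mem_some_iff.1 hr
      filter_upwards [hU] with p' hp' r' hr'
      rwa [Part.mem_some_iff.1 hr']⟩

end Problem

/-- Put a symbol in front of a sequence. -/
def cons (m : ℕ) (p : Baire) : Baire := fun n => Nat.casesOn n m p

namespace Code

/-! ### Some programs -/

theorem ofNat_surjective : Function.Surjective ofNat := by
  intro c
  induction c with
  | zero => exact ⟨0, by simp [ofNat]⟩
  | succ => exact ⟨1, by simp [ofNat]⟩
  | left => exact ⟨2, by simp [ofNat]⟩
  | right => exact ⟨3, by simp [ofNat]⟩
  | oracle => exact ⟨4, by simp [ofNat]⟩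
  | pair cf cg hf hg =>
    obtain ⟨a, rfl⟩ := hf
    obtain ⟨b, rfl⟩ := hg
    exact ⟨Nat.bit false (Nat.bit false (Nat.pair a b)) + 5, by
      rw [ofNat]; simp only [Nat.bodd_bit, Nat.div2_bit, Nat.unpair_pair]⟩
  | comp cf cg hf hg =>
    obtain ⟨a, rfl⟩ := hf
    obtain ⟨b, rfl⟩ := hg
    exact ⟨Nat.bit false (Nat.bit true (Nat.pair a b)) + 5, by
      rw [ofNat]; simp only [Nat.bodd_bit, Nat.div2_bit, Nat.unpair_pair]⟩
  | prec cf cg hf hg =>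
    obtain ⟨a, rfl⟩ := hf
    obtain ⟨b, rfl⟩ := hg
    exact ⟨Nat.bit true (Nat.bit false (Nat.pair a b)) + 5, by
      rw [ofNat]; simp only [Nat.bodd_bit, Nat.div2_bit, Nat.unpair_pair]⟩
  | rfind' cf hf =>
    obtain ⟨a, rfl⟩ := hf
    exact ⟨Nat.bit true (Nat.bit true a) + 5, by
      rw [ofNat]; simp only [Nat.bodd_bit, Nat.div2_bit]⟩

/-- A program for the identity on numbers. -/
def ident : Code := pair left right

theorem mem_ident (o : Baire) (n : ℕ) : n ∈ ident.eval o n :=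
  mem_eval_pair.2 ⟨_, _, Part.mem_some _, Part.mem_some _, Nat.pair_unpair n⟩

/-- A program for a constant function on numbers. -/
def const : ℕ → Code
  | 0 => zero
  | m + 1 => comp succ (const m)

theorem mem_const (o : Baire) (m n : ℕ) : m ∈ (const m).eval o n := by
  induction m with
  | zero => exact Part.mem_some _
  | succ m ih => exact mem_eval_comp.2 ⟨m, ih, Part.mem_some _⟩

/-- If `c` computes `p`, then `consCode m c` computes `p` with the symbol `m` put in front. -/
def consCode (m : ℕ) (c : Code) : Code :=
  comp (prec (const m) (comp c (comp left right))) (pair zero ident)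

theorem cons_mem_functional {m : ℕ} {c : Code} {o p : Baire} (h : p ∈ c.functional o) :
    cons m p ∈ (consCode m c).functional o := by
  rw [mem_functional] at h ⊢
  intro n
  -- The recursion has the dummy parameter `0`; its step to `n + 1` discards the previous value and
  -- prints `p n`.
  refine mem_eval_comp.2 ⟨Nat.pair 0 n,
    mem_eval_pair.2 ⟨0, n, Part.mem_some _, mem_ident o n, rfl⟩, ?_⟩
  induction n with
  | zero => rw [eval_prec_zero]; exact mem_const o m 0
  | succ n ih =>
    refine mem_eval_prec_succ.2 ⟨_, ih, mem_eval_comp.2 ⟨n, mem_eval_comp.2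
      ⟨Nat.pair n (cons m p n), ?_, ?_⟩, h n⟩⟩ <;> simp [eval]

end Code

theorem continuous_cons (m : ℕ) : Continuous (cons m) :=
  continuous_pi fun n => match n with
    | 0 => continuous_const
    | n + 1 => continuous_apply n

theorem Phi_cons {m : ℕ} {c : Code} (h : Code.ofNat m = c) (p q : Baire) :
    Phi (cons m p) q = c.functional (pair p q) := by
  subst h
  rfl

/-! ### Continuous functions from tables -/

/-- The code of the first `k` symbols of `p`. -/
def prefixCode (p : Baire) : ℕ → ℕ
  | 0 => 0
  | k + 1 => Nat.pair (prefixCode p k) (p k)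

theorem eq_of_prefixCode_eq {p p' : Baire} {k : ℕ} (h : prefixCode p k = prefixCode p' k) :
    ∀ i < k, p i = p' i := by
  induction k with
  | zero => simp
  | succ k ih =>
    obtain ⟨h1, h2⟩ := Nat.pair_eq_pair.1 h
    intro i hi
    rcases Nat.lt_succ_iff_lt_or_eq.1 hi with hi | rfl
    · exact ih h1 i hi
    · exact h2

/-- On input `⟨n, k⟩`, look up the entry `⟨n, ⟨k, p|ₖ⟩⟩` of the table computed by `t`, where `p` is
computed by `c`. -/
def Code.lookup (t c : Code) : Code :=
  .comp t (.pair .left (.pair .right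
    (.prec .zero (.pair (.comp .right .right) (.comp c (.comp .left .right))))))

theorem Code.mem_lookup {t c : Code} {o q p : Baire} (ht : q ∈ t.functional o)
    (hc : p ∈ c.functional o) (n k : ℕ) :
    q (Nat.pair n (Nat.pair k (prefixCode p k))) ∈ (lookup t c).eval o (Nat.pair n k) := by
  rw [mem_functional] at ht hc
  refine mem_eval_comp.2 ⟨_, mem_eval_pair.2 ⟨n, _, by simp [eval], mem_eval_pair.2
    ⟨k, prefixCode p k, by simp [eval], ?_, rfl⟩, rfl⟩, ht _⟩
  induction k with
  | zero => rw [eval_prec_zero]; exact Part.mem_some 0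
  | succ k ih =>
    refine mem_eval_prec_succ.2 ⟨_, ih, mem_eval_pair.2 ⟨prefixCode p k, p k,
      mem_eval_comp.2 ⟨Nat.pair k (prefixCode p k), ?_, ?_⟩,
      mem_eval_comp.2 ⟨k, mem_eval_comp.2 ⟨Nat.pair k (prefixCode p k), ?_, ?_⟩, hc k⟩, rfl⟩⟩ <;>
    simp [eval]

/-- Evaluate at the point computed by `c` the continuous function whose table of moduli is computed
by `t` and whose table of values is computed by `d`. -/
def Code.applyTable (t d c : Code) : Code :=
  .comp (lookup d c) (.pair ident (.comp (.rfind' (lookup t c)) (.pair ident .zero)))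

/-- A zero entry of `q` marks a prefix long enough to decide the `n`-th symbol. The unbounded search
finds the least such length; it halts by `hex`, and by `hval` the value stored there is correct. -/
theorem Code.mem_applyTable {t d c : Code} {o q s p r : Baire} (ht : q ∈ t.functional o)
    (hd : s ∈ d.functional o) (hc : p ∈ c.functional o)
    (hex : ∀ n, ∃ k, q (Nat.pair n (Nat.pair k (prefixCode p k))) = 0)
    (hval : ∀ n k, q (Nat.pair n (Nat.pair k (prefixCode p k))) = 0 →
      s (Nat.pair n (Nat.pair k (prefixCode p k))) = r n) :
    r ∈ (applyTable t d c).functional o := by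
  classical
  rw [mem_functional]
  intro n
  have h0 := Nat.find_spec (hex n)
  refine mem_eval_comp.2 ⟨Nat.pair n (Nat.find (hex n)), mem_eval_pair.2 ⟨n, _, mem_ident o n,
    mem_eval_comp.2 ⟨Nat.pair n 0, mem_eval_pair.2 ⟨n, 0, mem_ident o n, Part.mem_some 0, rfl⟩,
      mem_eval_rfind'.2 ⟨Nat.find (hex n), rfl, ?_, fun i hi => ?_⟩⟩, rfl⟩, ?_⟩
  · have := mem_lookup ht hc n (Nat.find (hex n))
    rwa [h0] at this
  · have := mem_lookup ht hc n i
    refine ⟨q (Nat.pair n (Nat.pair i (prefixCode p i))) - 1, ?_⟩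
    rwa [Nat.sub_add_cancel (Nat.pos_of_ne_zero (Nat.find_min (hex n) hi))]
  · have := mem_lookup hd hc n (Nat.find (hex n))
    rwa [hval _ _ h0] at this

/-- Every continuous partial function on Baire space has a table of moduli and a table of values. -/
theorem IsContinuous.exists_table {F : Baire →. Baire} (hF : IsContinuous F) :
    ∃ q s : Baire, ∀ p, ∀ r ∈ F p,
      (∀ n, ∃ k, q (Nat.pair n (Nat.pair k (prefixCode p k))) = 0) ∧
      ∀ n k, q (Nat.pair n (Nat.pair k (prefixCode p k))) = 0 →
        s (Nat.pair n (Nat.pair k (prefixCode p k))) = r n := by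
  classical
  rw [isContinuous_iff] at hF
  -- The prefix of length `k` with code `e` forces the `n`-th output symbol to be `w`.
  let good (n k e w : ℕ) : Prop := ∀ p', ∀ r' ∈ F p', prefixCode p' k = e → r' n = w
  have hs : ∀ n k e, ∃ w, (∃ w, good n k e w) → good n k e w := fun n k e => by
    by_cases h : ∃ w, good n k e w
    · exact ⟨h.choose, fun h' => h.choose_spec⟩
    -- This default is never used: the table of moduli has entry `1` here.
    · exact ⟨0, fun h' => absurd h' h⟩
  choose s hs using hs
  refine ⟨fun x => if ∃ w, good x.unpair.1 x.unpair.2.unpair.1 x.unpair.2.unpair.2 w then 0 else 1,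
    fun x => s x.unpair.1 x.unpair.2.unpair.1 x.unpair.2.unpair.2, fun p r hr => ⟨fun n => ?_,
      fun n k hk => ?_⟩⟩
  · have hU : {r' : Baire | r' n = r n} ∈ 𝓝 r :=
      (continuous_apply n).continuousAt ((isOpen_discrete {r n}).mem_nhds rfl)
    obtain ⟨t, ⟨x, k, rfl⟩, hxp, ht⟩ := (PiNat.isTopologicalBasis_cylinders _).mem_nhds_iff.1
      (hF p r hr _ hU)
    refine ⟨k, ?_⟩
    simp only [Nat.unpair_pair, ite_eq_left_iff, one_ne_zero, imp_false, not_not]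
    refine ⟨r n, fun p' r' hr' hp' => ht (fun i hi => ?_) r' hr'⟩
    rw [eq_of_prefixCode_eq hp' i hi, hxp i hi]
  · simp only [Nat.unpair_pair, ite_eq_left_iff, one_ne_zero, imp_false, not_not] at hk ⊢
    exact (hs _ _ _ hk p r hr rfl).symm

namespace Problem

/-! ### The implication -/

/-- If `p` computes answers to `u` from answers to `x`, then `p` together with a name of `x` is a
name of a solution of the implication at `u`. -/
theorem exists_mem_arrow {g : Problem.{w, z}} {f : Problem.{u, v}} {x : g.X.carrier}
    {u : f.X.carrier} {p a : Baire} (ha : x ∈ g.X.δ a) (hx : x ∈ g.dom)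
    (h : ∀ y ∈ g.f x, ∀ q, y ∈ g.Y.δ (fst q) →
      ∃ r ∈ Phi p q, ∃ b ∈ f.Y.δ r, b ∈ f.f u) :
    ∃ y ∈ (g.arrow f).Y.δ (pair p a), y ∈ (g.arrow f).f u := by
  have hne : ∀ y ∈ g.f x, (RepSpace.phiMulti g.Y f.Y p y).Nonempty := by
    intro y hy
    obtain ⟨q, hq⟩ := g.Y.surj y
    -- Only the first component of a cylinder name matters; the second is arbitrary.
    have hq' : y ∈ g.Y.δ (fst (pair q q)) := by rwa [fst_pair]
    obtain ⟨r, hr, b, hb, -⟩ := h y hy _ hq'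
    refine ⟨b, fun q hq => ?_, pair q q, hq', r, hr, hb⟩
    obtain ⟨r, hr, b, hb, -⟩ := h y hy q hq
    exact ⟨r, hr, Part.dom_iff_mem.2 ⟨b, hb⟩⟩
  refine ⟨(⟨RepSpace.phiMulti g.Y f.Y p, p, rfl⟩, x), ?_, ?_, ?_⟩
  · refine Part.mem_bind (a := ⟨RepSpace.phiMulti g.Y f.Y p, p, rfl⟩) ?_
      ((Part.mem_map_iff _).2 ⟨x, ?_, rfl⟩)
    · rw [fst_pair]
      exact Part.mem_some _
    · rwa [snd_pair]
  · obtain ⟨y, hy⟩ := hx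
    obtain ⟨b, hb⟩ := hne y hy
    exact ⟨b, hne, y, hy, hb⟩
  · rintro b ⟨-, y, hy, -, q, hq, r, hr, hb⟩
    obtain ⟨r', hr', b', hb', hf⟩ := h y hy q hq
    obtain rfl := Part.mem_unique hr hr'
    rwa [Part.mem_unique hb hb']

theorem IsContinuous.arrow {f : Problem.{u, v}} (hf : f.IsContinuous) {g : Problem.{w, z}}
    (hg : g.dom.Nonempty) : (g.arrow f).IsContinuous := by
  obtain ⟨F, hF, hFc⟩ := hf
  obtain ⟨x, hx⟩ := hg
  obtain ⟨a, ha⟩ := g.X.surj x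
  -- The machine sees `pair r q` and prints its parameter `r`, ignoring the answer `q`.
  obtain ⟨m, hm⟩ := Code.ofNat_surjective (.comp .left .oracle)
  refine ⟨F.map fun r => pair (cons m r) a, fun p u hp hu => ?_, hFc.map ?_⟩
  · have hu' : u ∈ f.dom := by
      obtain ⟨y, ⟨b, hb⟩, hy⟩ := hu
      exact ⟨b, hy hb⟩
    obtain ⟨r, hr, b, hb, hbu⟩ := hF p u hp hu'
    refine ⟨_, (Part.mem_map_iff _).2 ⟨r, hr, rfl⟩, exists_mem_arrow ha hx fun y _ q _ => ?_⟩
    refine ⟨r, ?_, b, hb, hbu⟩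
    rw [Phi_cons hm]
    simpa using Code.fst_mem_functional (pair r q)
  · exact continuous_pair.comp ((continuous_cons m).prodMk continuous_const)

/-- Given a name `p` of an instance `u` of `f`, a reduction of `f` to `g` produces a name of an
instance of `g` each of whose solutions it turns into a solution of `u`. -/
theorem exists_instance_of_sandwich {f : Problem.{u, v}} {g : Problem.{w, z}}
    {K H : Baire →. Baire} (h : ∀ G, Realizes G g → Realizes (sandwich K H G) f) {p : Baire}
    {u : f.X.carrier} (hp : u ∈ f.X.δ p) (hu : u ∈ f.dom) :
    ∃ a ∈ H p, ∃ x ∈ g.X.δ a, x ∈ g.dom ∧ ∀ y ∈ g.f x, ∀ q, y ∈ g.Y.δ q →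
      ∃ r ∈ K (pair p q), ∃ b ∈ f.Y.δ r, b ∈ f.f u := by
  classical
  have hex : ∀ s : Baire, (∃ x ∈ g.X.δ s, x ∈ g.dom) →
      ∃ r, ∃ x ∈ g.X.δ s, ∃ y ∈ g.Y.δ r, y ∈ g.f x := by
    rintro s ⟨x, hs, y, hy⟩
    obtain ⟨r, hr⟩ := g.Y.surj y
    exact ⟨r, x, hs, y, hr, hy⟩
  -- `G` is defined only on names of points of `g.dom`, so the mere convergence of the sandwich
  -- shows that `H p` contains such a name `a`.
  let G : Baire →. Baire := fun s => ⟨_, fun hs => (hex s hs).choose⟩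
  have hG : Realizes G g := by
    intro s x hs hx
    obtain ⟨x', hs', y, hy, hyx⟩ := (hex s ⟨x, hs, hx⟩).choose_spec
    obtain rfl := Part.mem_unique hs hs'
    exact ⟨_, ⟨⟨x, hs, hx⟩, rfl⟩, y, hy, hyx⟩
  obtain ⟨r, hr, -⟩ := h G hG p u hp hu
  obtain ⟨a, ha, hr⟩ := Part.mem_bind_iff.1 hr
  obtain ⟨-, ⟨⟨x, hax, hx⟩, -⟩, -⟩ := Part.mem_bind_iff.1 hr
  refine ⟨a, ha, x, hax, hx, fun y hy q hq => ?_⟩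
  -- Changing the realizer at `a` alone makes it return any prescribed correct answer.
  let G' : Baire →. Baire := fun s => if s = a then Part.some q else G s
  have hG' : Realizes G' g := by
    intro s x' hs hx'
    by_cases hsa : s = a
    · subst hsa
      obtain rfl := Part.mem_unique hax hs
      exact ⟨q, by simp [G'], y, hq, hy⟩
    · obtain ⟨r, hr, h⟩ := hG s x' hs hx'
      exact ⟨r, by simpa [G', hsa] using hr, h⟩
  obtain ⟨r, hr, hb⟩ := h G' hG' p u hp hu
  obtain ⟨a', ha', hr⟩ := Part.mem_bind_iff.1 hr
  obtain rfl := Part.mem_unique ha ha'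
  obtain ⟨q', hq', hr⟩ := Part.mem_bind_iff.1 hr
  have : q' = q := by simpa [G'] using hq'
  exact ⟨r, this ▸ hr, hb⟩

/-- The reduction solves the implication: the instance is named by `H p`, and the map back is `K`
with `p` as parameter. Both are computed from `p` alone, so the answer from `1` is discarded. -/
theorem Reducible.arrow_reducible_one {f : Problem.{u, v}} {g : Problem.{w, z}}
    (h : f.Reducible g) : (g.arrow f).Reducible one.{u₁} := by
  obtain ⟨K, H, ⟨k, hk⟩, ⟨c, hc⟩, hKH⟩ := h
  -- On `pair p q` this program runs `k` on `pair p (fst q)`, since `q` is a cylinder name and the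
  -- actual name of the answer is `fst q`.
  obtain ⟨m, hm⟩ := Code.ofNat_surjective (Code.subst
    (.pair (.comp .left .oracle) (Code.subst (.comp .right .oracle) (.comp .left .oracle))) k)
  refine ⟨fun r => (H (fst r)).map fun a => pair (cons m (fst r)) a, fun p => Part.some p,
    ⟨.pair (Code.consCode m (.comp .left .oracle)) (Code.subst (.comp .left .oracle) c),
      fun p r hr => ?_⟩, ⟨.oracle, fun p r hr => ?_⟩, fun G hG p u hp hu => ?_⟩
  · obtain ⟨a, ha, rfl⟩ := (Part.mem_map_iff _).1 hr
    exact Code.mem_functional_pair (Code.cons_mem_functional (Code.fst_mem_functional p))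
      (Code.mem_functional_subst (Code.fst_mem_functional p) (hc _ _ ha))
  · obtain rfl := Part.mem_some_iff.1 hr
    exact Code.self_mem_functional _
  · have hu' : u ∈ f.dom := by
      obtain ⟨y, ⟨b, hb⟩, hy⟩ := hu
      exact ⟨b, hy hb⟩
    obtain ⟨a, ha, x, hax, hx, hK⟩ := exists_instance_of_sandwich hKH hp hu'
    obtain ⟨s, hs, -⟩ := hG p PUnit.unit (Part.mem_some _) ⟨PUnit.unit, rfl⟩
    refine ⟨pair (cons m p) a, Part.mem_bind (Part.mem_some p) (Part.mem_bind hs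
      ((Part.mem_map_iff _).2 ⟨a, by rwa [fst_pair], by rw [fst_pair]⟩)),
      exists_mem_arrow hax hx fun y hy q hq => ?_⟩
    obtain ⟨r, hr, hb⟩ := hK y hy _ hq
    refine ⟨r, ?_, hb⟩
    rw [Phi_cons hm]
    refine Code.mem_functional_subst (Code.mem_functional_pair (p := p) ?_
      (Code.mem_functional_subst (Code.snd_mem_functional _) (Code.fst_mem_functional _)))
      (hk _ _ ?_)
    · simpa using Code.fst_mem_functional (pair p q)
    · rwa [snd_pair]

/-! ### Problems with a single instance as oracles -/

/-- The problem on Baire space whose only instance is the point `q`. -/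
def point (q : Baire) : Problem.{w, z} where
  X := { carrier := ULift Baire
         δ := fun p => Part.some ⟨p⟩
         surj := fun x => ⟨x.down, Part.mem_some _⟩ }
  Y := RepSpace.one
  f := fun x => {_y | x.down = q}

theorem dom_point_nonempty (q : Baire) : (point.{w, z} q).dom.Nonempty :=
  ⟨⟨q⟩, PUnit.unit, rfl⟩

/-- Every solution of `(point q → 1)` has names from which `q` can be computed. -/
theorem eq_of_mem_point_arrow {q r : Baire} {y : ((point.{w, z} q).arrow one.{u}).Y.carrier}
    {x : PUnit} (hr : y ∈ ((point.{w, z} q).arrow one.{u}).Y.δ r)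
    (hy : y ∈ ((point.{w, z} q).arrow one.{u}).f x) : snd r = q := by
  obtain ⟨h, -, hr⟩ := Part.mem_bind_iff.1 hr
  obtain ⟨s, hs, rfl⟩ := (Part.mem_map_iff _).1 hr
  -- The composition has a value, which forces its argument to be an instance of `point q`.
  obtain ⟨⟨b, -, y, hy, -⟩, -⟩ := hy
  rw [Part.mem_some_iff.1 hs] at hy
  exact hy

theorem IsContinuous.exists_reducible_point_arrow {f : Problem.{u, v}} (hf : f.IsContinuous) :
    ∃ q, f.Reducible ((point.{w, z} q).arrow one.{u₁}) := by
  obtain ⟨F, hF, hFc⟩ := hf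
  obtain ⟨q, s, hqs⟩ := hFc.exists_table
  let snd' : Code := .comp .right .oracle
  let t : Code := Code.subst snd' (Code.subst snd' (.comp .left .oracle))
  let d : Code := Code.subst snd' (Code.subst snd' snd')
  refine ⟨pair q s, (Code.applyTable t d (.comp .left .oracle)).functional,
    Code.oracle.functional, ⟨_, fun _ _ h => h⟩, ⟨_, fun _ _ h => h⟩, fun G hG p u hp hu => ?_⟩
  obtain ⟨a, ha⟩ := (point.{w, z} (pair q s)).X.surj ⟨pair q s⟩
  obtain ⟨m, hm⟩ := Code.ofNat_surjective .oracle
  -- A realizer must answer only on the domain. Any total machine shows that a solution exists,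
  -- because every sequence names the one point.
  have hdom : PUnit.unit ∈ ((point.{w, z} (pair q s)).arrow one.{u₁}).dom := by
    obtain ⟨y, -, hy⟩ := exists_mem_arrow (f := one.{u₁}) (u := PUnit.unit) (p := cons m p) ha
      ⟨PUnit.unit, rfl⟩ fun _ _ q _ => ⟨pair p q, Phi_cons hm p q ▸ Code.self_mem_functional _,
        PUnit.unit, Part.mem_some _, rfl⟩
    exact ⟨y, hy⟩
  obtain ⟨r, hr, y, hy, hyu⟩ := hG p PUnit.unit (Part.mem_some _) hdom
  have hrq := eq_of_mem_point_arrow hy hyu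
  obtain ⟨b, hb, hbu⟩ := hF p u hp hu
  refine ⟨b, Part.mem_bind (Code.self_mem_functional p) (Part.mem_bind hr ?_), hbu⟩
  have h₁ : pair q s ∈ (Code.subst snd' snd').functional (pair p r) := by
    refine Code.mem_functional_subst (Code.snd_mem_functional _) ?_
    rw [snd_pair, ← hrq]
    exact Code.snd_mem_functional r
  have ht : q ∈ t.functional (pair p r) := by
    refine Code.mem_functional_subst (Code.snd_mem_functional _) ?_
    rw [snd_pair]
    refine Code.mem_functional_subst (Code.snd_mem_functional _) ?_
    rw [hrq]
    simpa using Code.fst_mem_functional (pair q s)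
  have hd : s ∈ d.functional (pair p r) := by
    refine Code.mem_functional_subst (Code.snd_mem_functional _) ?_
    rw [snd_pair]
    refine Code.mem_functional_subst (Code.snd_mem_functional _) ?_
    rw [hrq]
    simpa using Code.snd_mem_functional (pair q s)
  have hc : p ∈ (Code.comp .left .oracle).functional (pair p r) := by
    simpa using Code.fst_mem_functional (pair p r)
  exact Code.mem_applyTable ht hd hc (hqs p b hb).1 (hqs p b hb).2

end Problem

/-! ### The implication with the top element, and the first claim -/

namespace ExtProblem

theorem of_reducible_arrow_point {f : Problem.{u, v}} (hf : f.IsContinuous) :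
    ∃ q, Reducible (.of f) (arrow (.of (Problem.point.{w, z} q)) (.of Problem.one.{u₁})) := by
  obtain ⟨q, hq⟩ := hf.exists_reducible_point_arrow
  refine ⟨q, ?_⟩
  rw [arrow, if_pos (Or.inl (Problem.dom_point_nonempty q))]
  exact hq

theorem not_reducible_zero {g : Problem.{w, z}} (hg : g.dom.Nonempty) :
    ¬ Reducible (.of g) (.of Problem.zero.{u, v}) := fun h =>
  hg.ne_empty (Problem.Reducible.dom_eq_empty h Problem.dom_zero)

/-- A problem below an implication with nonzero premise and continuous conclusion is continuous. -/
theorem isContinuous_of_reducible_arrow {f : Problem.{u, v}} {g : ExtProblem.{w, z}}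
    {e : Problem.{u₁, v₁}} (hg : ∀ g', g = .of g' → g'.dom.Nonempty) (he : e.IsContinuous)
    (h : Reducible (.of f) (arrow g (.of e))) : f.IsContinuous := by
  cases g with
  | infty => exact (Problem.isContinuous_of_dom_eq_empty Problem.dom_zero).of_reducible h
  | of g =>
    rw [arrow, if_pos (Or.inl (hg g rfl))] at h
    exact (he.arrow (hg g rfl)).of_reducible h

theorem arrow_reducible_one {g f : ExtProblem.{u, v}} (h : Reducible f g) :
    Reducible (arrow g f) (.of Problem.one.{w}) := by
  cases g with
  | infty => exact Problem.Reducible.of_dom_eq_empty Problem.dom_zero _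
  | of g =>
    cases f with
    | infty => exact h.elim
    | of f =>
      -- This excludes the case in which the implication is `∞`: below a nowhere defined problem
      -- there are only nowhere defined ones.
      have : g.dom.Nonempty ∨ f.dom = ∅ := by
        rcases g.dom.eq_empty_or_nonempty with hg | hg
        · exact .inr (Problem.Reducible.dom_eq_empty h hg)
        · exact .inl hg
      rw [arrow, if_pos this]
      exact Problem.Reducible.arrow_reducible_one h

theorem one_reducible_arrow_one :
    Reducible (.of Problem.one.{0}) (arrow (.of Problem.one.{0}) (.of Problem.one.{0})) := by
  have h1 : Problem.one.{0}.dom.Nonempty := ⟨PUnit.unit, PUnit.unit, rfl⟩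
  rw [arrow, if_pos (Or.inl h1)]
  refine ⟨fun _ => Part.some 0, fun p => Part.some p, ⟨.zero, fun p r hr => ?_⟩,
    ⟨.oracle, fun p r hr => ?_⟩, fun G hG p u hp hu => ?_⟩
  · obtain rfl := Part.mem_some_iff.1 hr
    exact Code.mem_functional.2 fun n => Part.mem_some _
  · obtain rfl := Part.mem_some_iff.1 hr
    exact Code.self_mem_functional _
  · obtain ⟨m, hm⟩ := Code.ofNat_surjective .oracle
    obtain ⟨y, -, hy⟩ := Problem.exists_mem_arrow (g := Problem.one.{0}) (f := Problem.one.{0})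
      (x := PUnit.unit) (u := PUnit.unit) (p := cons m p) (a := p) (Part.mem_some _)
      ⟨PUnit.unit, rfl⟩ fun _ _ q _ => ⟨pair p q, Phi_cons hm p q ▸ Code.self_mem_functional _,
        PUnit.unit, Part.mem_some _, rfl⟩
    obtain ⟨r, hr, -⟩ := hG p PUnit.unit (Part.mem_some _) ⟨y, hy⟩
    exact ⟨0, Part.mem_bind (Part.mem_some p) (Part.mem_bind hr (Part.mem_some _)),
      PUnit.unit, Part.mem_some _, rfl⟩

theorem zero_reducible (g : ExtProblem.{w, z}) : Reducible (.of Problem.zero.{u, v}) g := by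
  cases g with
  | infty => trivial
  | of g => exact Problem.Reducible.of_dom_eq_empty Problem.dom_zero g

theorem isContinuous_iff_exists (f : Problem.{u, v}) :
    f.IsContinuous ↔ ∃ g : ExtProblem.{w, z},
      StrictReducible (.of Problem.zero.{u₁, v₁}) g ∧
        Reducible (.of f) (arrow g (.of Problem.one.{u₂})) := by
  constructor
  · intro hf
    obtain ⟨q, hq⟩ := of_reducible_arrow_point hf
    exact ⟨_, ⟨zero_reducible _, not_reducible_zero (Problem.dom_point_nonempty q)⟩, hq⟩
  · rintro ⟨g, ⟨-, hg⟩, h⟩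
    refine isContinuous_of_reducible_arrow (fun g' hg' => ?_) Problem.isContinuous_one h
    subst hg'
    by_contra hne
    exact hg (Problem.Reducible.of_dom_eq_empty (Set.not_nonempty_iff_eq_empty.1 hne) _)

end ExtProblem

/-! ### Definability -/

theorem deg_surjective : Function.Surjective deg := Quotient.mk_surjective

theorem deg_eq_deg {f g : ExtProblem.{0, 0}} :
    deg f = deg g ↔ f.Reducible g ∧ g.Reducible f :=
  Quotient.eq

theorem Degree.le_iff {f g : ExtProblem.{0, 0}} :
    Degree.le (deg f) (deg g) ↔ f.Reducible g := by
  constructor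
  · rintro ⟨f', g', hf, hg, h⟩
    exact _root_.trans (_root_.trans (deg_eq_deg.1 hf).2 h) (deg_eq_deg.1 hg).1
  · exact fun h => ⟨f, g, rfl, rfl, h⟩

/-- A degree is that of `0` iff it is the least one. -/
def Degree.IsLeast (c : Degree) : Prop := ∀ d, Degree.le c d

/-- The degree of `1` is the greatest degree of the form `(a → a)`. -/
def Degree.IsOne (e : Degree) : Prop :=
  (∃ a, Degree.IsArrow a a e) ∧ ∀ a b, Degree.IsArrow a a b → Degree.le b e

theorem Degree.isOne_iff {e : Degree} : e.IsOne ↔ e = deg (.of Problem.one) := by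
  -- `IsArrow a a b` may use two different representatives of `a`; hence the bound by `1` was proved
  -- for all `f ≤ g`.
  have hle : ∀ a b, Degree.IsArrow a a b → Degree.le b (deg (.of Problem.one)) := by
    rintro a b ⟨g, f, rfl, hf, rfl⟩
    exact le_iff.2 (ExtProblem.arrow_reducible_one (deg_eq_deg.1 hf).1)
  have hone : Degree.IsArrow (deg (.of Problem.one)) (deg (.of Problem.one))
      (deg (.of Problem.one)) :=
    ⟨_, _, rfl, rfl, deg_eq_deg.2 ⟨ExtProblem.arrow_reducible_one (Problem.Reducible.refl _),
      ExtProblem.one_reducible_arrow_one⟩⟩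
  constructor
  · rintro ⟨⟨a, ha⟩, h⟩
    have h₁ := hle a e ha
    have h₂ := h _ _ hone
    obtain ⟨e, rfl⟩ := deg_surjective e
    exact deg_eq_deg.2 ⟨le_iff.1 h₁, le_iff.1 h₂⟩
  · rintro rfl
    exact ⟨⟨_, hone⟩, hle⟩

theorem Degree.isContinuous_iff {a : Degree} :
    a.IsContinuous ↔ ∃ e c b, Degree.IsOne e ∧ ¬ Degree.IsLeast c ∧ Degree.IsArrow c e b ∧
      Degree.le a b := by
  constructor
  · rintro ⟨f, hf, rfl⟩
    obtain ⟨q, hq⟩ := ExtProblem.of_reducible_arrow_point.{0, 0, 0, 0, 0} hf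
    exact ⟨_, _, _, isOne_iff.2 rfl, fun h => ExtProblem.not_reducible_zero
      (Problem.dom_point_nonempty q) (le_iff.1 (h (deg (.of Problem.zero)))),
      ⟨_, _, rfl, rfl, rfl⟩, le_iff.2 hq⟩
  · rintro ⟨e, c, b, he, hc, ⟨g, f, rfl, rfl, rfl⟩, hab⟩
    obtain ⟨a, rfl⟩ := deg_surjective a
    have hab := le_iff.1 hab
    have hf := (deg_eq_deg.1 (isOne_iff.1 he)).1
    cases f with
    | infty => exact hf.elim
    | of f =>
      have hg : ∀ g', g = .of g' → g'.dom.Nonempty := by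
        rintro g rfl
        by_contra hne
        refine hc fun d => ?_
        obtain ⟨d, rfl⟩ := deg_surjective d
        refine le_iff.2 ?_
        cases d with
        | infty => trivial
        | of d => exact Problem.Reducible.of_dom_eq_empty (Set.not_nonempty_iff_eq_empty.1 hne) d
      -- The representative `f` is only equivalent to `1`, but that already makes it continuous.
      have hfc := Problem.isContinuous_one.of_reducible hf
      cases a with
      | of a => exact ⟨a, ExtProblem.isContinuous_of_reducible_arrow hg hfc hab, rfl⟩
      | infty =>
        cases g with
        | infty => exact hab.elim
        | of g =>
          rw [ExtProblem.arrow, if_pos (Or.inl (hg g rfl))] at hab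
          exact hab.elim

open FirstOrder FirstOrder.Language in
/-- The formula `∃ e c b, e = 1 ∧ c ≠ 0 ∧ (c → e) = b ∧ a ≤ b`. -/
def continuousFormula : degreeLanguage.Formula (Fin 1) :=
  let le {n : ℕ} (s t : degreeLanguage.Term (Fin 1 ⊕ Fin n)) :
      degreeLanguage.BoundedFormula (Fin 1) n :=
    Relations.boundedFormula (L := degreeLanguage) DegreeRel.le ![s, t]
  let arrow {n : ℕ} (s t r : degreeLanguage.Term (Fin 1 ⊕ Fin n)) :
      degreeLanguage.BoundedFormula (Fin 1) n :=
    Relations.boundedFormula (L := degreeLanguage) DegreeRel.arrow ![s, t, r]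
  -- Bound variables are counted from the outermost quantifier: `x 0`, `x 1`, `x 2` are `e`, `c`,
  -- `b`, and later indices belong to inner quantifiers.
  let x {n : ℕ} (i : Fin n) : degreeLanguage.Term (Fin 1 ⊕ Fin n) := .var (.inr i)
  let isOne : degreeLanguage.BoundedFormula (Fin 1) 3 :=
    (arrow (n := 4) (x 3) (x 3) (x 0)).ex ⊓
      ((arrow (n := 5) (x 3) (x 3) (x 4)).imp (le (x 4) (x 0))).all.all
  (isOne ⊓ ((le (n := 4) (x 1) (x 3)).all.not ⊓
    (arrow (x 1) (x 0) (x 2) ⊓ le (.var (.inl 0)) (x 2)))).ex.ex.ex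

theorem realize_continuousFormula (x : Fin 1 → Degree) :
    continuousFormula.Realize x ↔ (x 0).IsContinuous := by
  rw [Degree.isContinuous_iff]
  simp only [continuousFormula, FirstOrder.Language.Formula.Realize,
    FirstOrder.Language.BoundedFormula.realize_ex, FirstOrder.Language.BoundedFormula.realize_all,
    FirstOrder.Language.BoundedFormula.realize_inf, FirstOrder.Language.BoundedFormula.realize_imp,
    FirstOrder.Language.BoundedFormula.realize_not]
  rfl

end Weihrauch

theorem proposition46 :
    (∀ f : Weihrauch.Problem.{u, v},
      f.IsContinuous ↔
        ∃ g : Weihrauch.ExtProblem.{w, z},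
          Weihrauch.ExtProblem.StrictReducible (.of Weihrauch.Problem.zero.{0, 0}) g ∧
          Weihrauch.ExtProblem.Reducible (.of f)
            (Weihrauch.ExtProblem.arrow g (.of Weihrauch.Problem.one.{0}))) ∧
    (∅ : Set Weihrauch.Degree).Definable₁ Weihrauch.degreeLanguage
      {a : Weihrauch.Degree | a.IsContinuous} := by
  refine ⟨Weihrauch.ExtProblem.isContinuous_iff_exists, ?_⟩
  rw [Set.Definable₁, Set.empty_definable_iff]
  exact ⟨Weihrauch.continuousFormula, Set.ext fun x =>
    (Weihrauch.realize_continuousFormula x).symm⟩
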